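/- **Setting (Huge Object model).** For $u,v\in\{0,1\}^n$ let $d_H(u,v)=\frac1n|\{j: u_j\neq v_j\}|$. For distributions $P,Q$ over $\{0,1\}^n$ let the earth mover's distance be $d(P,Q)=\min_T \mathbb E_{(u,v)\sim T}[d_H(u,v)]$, where $T$ ranges over the distributions on $\{0,1\}^n\times\{0,1\}^n$ with marginals $P$ and $Q$. For a set $\mathcal P$ of distributions let $d(P,\mathcal P)=\inf_{Q\in\mathcal P}d(P,Q)$. Let $\mathcal S_m$ be the property of being supported by at most $m$ elements. A (possibly adaptive) probabilistic algorithm with $s$ samples and at most $q$ queries on strings of length $n$ is a probability distribution over decision trees of height at most $q$: each internal node queries a pair $(i,j)\in\{1,\dots,s\}\times\{1,\dots,n\}$, the answer being the $j$-th bit of the $i$-th sample, and each leaf either accepts or rejects. On an input distribution $P$ over $\{0,1\}^n$, a tree is drawn, $s$ independent samples are drawn from $P$ (independently of the tree), and the tree is run on them. The algorithm is a one-sided $\varepsilon$-test of $\mathcal S_m$ (for length $n$) if it accepts every distribution $P\in\mathcal S_m$ over $\{0,1\}^n$ with probability $1$, and rejects every distribution $P$ over $\{0,1\}^n$ with $d(P,\mathcal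 S_m)>\varepsilon$ with probability greater than $\frac23$. **Statement.** There exist absolute constants $c>0$ and $\varepsilon_0>0$ such that for every integer $m\ge 2$ there are infinitely many string lengths $n$ for which the following holds: for every $0<\varepsilon<\varepsilon_0$, if a one-sided (possibly adaptive) $\varepsilon$-test of $\mathcal S_m$ for distributions over $\{0,1\}^n$, with any number $s$ of samples, makes at most $q$ queries, then $$q\;\ge\; c\,\varepsilon^{-1}\, m\log m .$$ -/

import Mathlib

open scoped ENNReal

namespace HugeObject

/-- Binary strings of length `n`. -/
abbrev Str (n : ℕ) : Type := Fin n → Bool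

/-- The normalized Hamming distance of two strings of length `n`. -/
noncomputable def strDist {n : ℕ} (u v : Str n) : ℝ≥0∞ :=
  (hammingDist u v : ℝ≥0∞) / (n : ℝ≥0∞)

/-- `T` is a transfer distribution from `P` to `Q`: its marginals are `P` and `Q`. -/
def IsTransfer {n : ℕ} (P Q : PMF (Str n)) (T : PMF (Str n × Str n)) : Prop :=
  T.map Prod.fst = P ∧ T.map Prod.snd = Q

/-- The earth mover's distance of two distributions over strings, with respect to `strDist`. -/
noncomputable def emd {n : ℕ} (P Q : PMF (Str n)) : ℝ≥0∞ :=
  ⨅ (T : PMF (Str n × Str n)) (_ : IsTransfer P Q T), ∑ uv, T uv * strDist uv.1 uv.2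

/-- The earth mover's distance of a distribution from a set of distributions. -/
noncomputable def distFrom {n : ℕ} (P : PMF (Str n)) (S : Set (PMF (Str n))) : ℝ≥0∞ :=
  ⨅ Q ∈ S, emd P Q

/-- The bounded support property: distributions over `n`-bit strings that are supported by at
most `m` elements. -/
def boundedSupport (m n : ℕ) : Set (PMF (Str n)) :=
  {P | P.support.ncard ≤ m}

/-- A deterministic adaptive algorithm over `s` samples of length `n`: a decision tree whose
internal nodes query bit `j` of sample `i` and continue according to the answer
(`t₀` for `0`, `t₁` for `1`), and whose leaves accept (`true`) or reject (`false`). -/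
inductive DecisionTree (s n : ℕ) : Type where
  | leaf (accept : Bool) : DecisionTree s n
  | query (i : Fin s) (j : Fin n) (t₀ t₁ : DecisionTree s n) : DecisionTree s n

namespace DecisionTree

/-- The height: the maximal number of queries on a path from the root to a leaf. -/
def height {s n : ℕ} : DecisionTree s n → ℕ
  | leaf _ => 0
  | query _ _ t₀ t₁ => max t₀.height t₁.height + 1

/-- The output of the algorithm when row `i` of the matrix `M` is the `i`-th sample. -/
def eval {s n : ℕ} (M : Fin s → Str n) : DecisionTree s n → Bool
  | leaf b => b
  | query i j t₀ t₁ => if M i j then t₁.eval M else t₀.eval M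

end DecisionTree

/-- The law of `s` independent samples from `P`. -/
noncomputable def iidSamples (s : ℕ) {n : ℕ} (P : PMF (Str n)) : PMF (Fin s → Str n) :=
  PMF.ofFintype (fun M => ∏ i, P (M i)) <| by
    have h : ∑ x, P x = 1 := by rw [← tsum_fintype (L := .unconditional _)]; exact P.tsum_coe
    rw [← Fintype.prod_sum (fun (_ : Fin s) x => P x)]
    simp [h]

/-- A probabilistic algorithm with `s` samples of length `n`: a distribution over deterministic
adaptive algorithms (the internal coin tosses are independent of the samples). -/
abbrev RandAlg (s n : ℕ) : Type := PMF (DecisionTree s n)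

/-- The law of the output (`true` is accept) of the algorithm `A` on the input distribution `P`. -/
noncomputable def RandAlg.output {s n : ℕ} (A : RandAlg s n) (P : PMF (Str n)) : PMF Bool :=
  A.bind fun t => (iidSamples s P).map fun M => t.eval M

/-- The algorithm `A` never makes more than `q` queries. -/
def RandAlg.MakesAtMost {s n : ℕ} (A : RandAlg s n) (q : ℕ) : Prop :=
  ∀ t ∈ A.support, t.height ≤ q

/-- `A` is an `ε`-test for the property `S` of distributions over `n`-bit strings. -/
def IsTest {s n : ℕ} (A : RandAlg s n) (ε : ℝ) (S : Set (PMF (Str n))) : Prop :=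
  (∀ P ∈ S, 2 / 3 < A.output P true) ∧
    ∀ P : PMF (Str n), ENNReal.ofReal ε < distFrom P S → 2 / 3 < A.output P false

/-- `A` is a one-sided `ε`-test: an `ε`-test that accepts every member of `S` with
probability `1`. -/
def IsOneSidedTest {s n : ℕ} (A : RandAlg s n) (ε : ℝ) (S : Set (PMF (Str n))) : Prop :=
  IsTest A ε S ∧ ∀ P ∈ S, A.output P true = 1

end HugeObject

/-! The hard input mixes, with weights `1 - η` and `η = 256 * ε`, a distribution `h` on at most `m /
2` strings and the uniform distribution. The marginals of `h` on any `k` coordinates are uniform,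
where `k` is of order `log m` (`exists_heavy`: parity strings of vectors any `k` of which are
independent). Let `X` be the support of `h`.

A one-sided tree may reject only if the bits it has read fit no matrix with at most `m` distinct
rows. A row read in at most `k` places can be replaced by an element of `X`, so rejection requires
more than about `m / 2` rows outside `X`, each read in more than `k` places
(`le_card_deep_of_eval_eq_false`). The first `k` bits of a row carry no information on which
component produced it, so whatever the adaptive strategy, a row that gets its query number `k + 1`
lies outside `X` with conditional probability at most `η` (`sum_notMem_le_of_prefix`). With `q`
queries at most `q / (k + 1)` rows are deep, so the expected number of deep rows outside `X` is at
most `η * q / (k + 1)`. Markov's inequality then makes `q` at least of order `m * (k + 1) / ε`.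

The input is far from the property because `m` small Hamming balls cover at most half of the cube,
which leaves mass `η / 2` to be moved by more than `1 / 64` (`le_distFrom_boundedSupport`).
Repeating each bit `r` times changes none of this and yields infinitely many lengths. -/

namespace HugeObject

/-! ### Adaptive queries against a product distribution. -/

namespace DecisionTree

variable {s n : ℕ}

/-- Rename the queried coordinates of a decision tree along `b`. -/
def relabel {n' : ℕ} (b : Fin n → Fin n') : DecisionTree s n → DecisionTree s n'
  | leaf c => leaf c
  | query i j t₀ t₁ => query i (b j) (t₀.relabel b) (t₁.relabel b)

theorem height_relabel {n' : ℕ} (b : Fin n → Fin n') (t : DecisionTree s n) :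
    (t.relabel b).height = t.height := by
  induction t with
  | leaf c => rfl
  | query i j t₀ t₁ h₀ h₁ => simp [relabel, height, h₀, h₁]

theorem eval_relabel {n' : ℕ} (b : Fin n → Fin n') (M : Fin s → Str n') (t : DecisionTree s n) :
    (t.relabel b).eval M = t.eval fun i j => M i (b j) := by
  induction t with
  | leaf c => rfl
  | query i j t₀ t₁ h₀ h₁ => simp [relabel, eval, h₀, h₁]

/-- The coordinates of row `i` that are queried when the tree is run on `M`. -/
def rowQueries (M : Fin s → Str n) (i : Fin s) : DecisionTree s n → Finset (Fin n)
  | leaf _ => ∅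
  | query i' j t₀ t₁ =>
    (if i' = i then {j} else ∅) ∪ (if M i' j then t₁.rowQueries M i else t₀.rowQueries M i)

theorem eval_congr {M M' : Fin s → Str n} (t : DecisionTree s n)
    (h : ∀ i, ∀ j ∈ t.rowQueries M i, M i j = M' i j) : t.eval M = t.eval M' := by
  induction t with
  | leaf c => rfl
  | query i j t₀ t₁ h₀ h₁ =>
    have hij : M i j = M' i j := h i j (by simp [rowQueries])
    cases hb : M i j with
    | false =>
      have := h₀ fun i' j' hj => h i' j' (by simp [rowQueries, hb, hj])
      simp [eval, ← hij, hb, this]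
    | true =>
      have := h₁ fun i' j' hj => h i' j' (by simp [rowQueries, hb, hj])
      simp [eval, ← hij, hb, this]

theorem sum_card_rowQueries_le (M : Fin s → Str n) (t : DecisionTree s n) :
    ∑ i, (t.rowQueries M i).card ≤ t.height := by
  induction t with
  | leaf c => simp [rowQueries]
  | query i j t₀ t₁ h₀ h₁ =>
    have h1 : ∑ i', (if i = i' then ({j} : Finset (Fin n)) else ∅).card = 1 := by
      simp [apply_ite Finset.card]
    calc ∑ i', ((query i j t₀ t₁).rowQueries M i').card
        ≤ ∑ i', ((if i = i' then ({j} : Finset (Fin n)) else ∅).card +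
            (if M i j then t₁.rowQueries M i' else t₀.rowQueries M i').card) :=
          Finset.sum_le_sum fun i' _ => Finset.card_union_le _ _
      _ = 1 + ∑ i', (if M i j then t₁.rowQueries M i' else t₀.rowQueries M i').card := by
          rw [Finset.sum_add_distrib, h1]
      _ ≤ max t₀.height t₁.height + 1 := by
          split_ifs <;> omega

/-- If among the strings with `k` prescribed bits the set `X` always misses at most an `η`-fraction,
then among the strings with more than `k` bits queried in row `i` it misses at most
an `η`-fraction. -/
theorem sum_notMem_le_of_prefix (p : Str n → ℝ≥0∞) (X : Finset (Str n)) (η : ℝ≥0∞) (k : ℕ)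
    (hp : ∀ J : Finset (Fin n), J.card = k → ∀ a : Str n,
      ∑ x with (∀ j ∈ J, x j = a j) ∧ x ∉ X, p x ≤ η * ∑ x with ∀ j ∈ J, x j = a j, p x)
    (i : Fin s) (M : Fin s → Str n) (t : DecisionTree s n) :
    ∀ J : Finset (Fin n), J.card ≤ k → ∀ a : Str n,
      ∑ x with (∀ j ∈ J, x j = a j) ∧
          (k < (J ∪ t.rowQueries (Function.update M i x) i).card ∧ x ∉ X), p x ≤
        η * ∑ x with (∀ j ∈ J, x j = a j) ∧
          k < (J ∪ t.rowQueries (Function.update M i x) i).card, p x := by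
  induction t with
  | leaf c =>
    intro J hJ a
    simp [rowQueries, hJ.not_gt]
  | query i' j t₀ t₁ h₀ h₁ =>
    intro J hJ a
    by_cases hi : i' = i
    · subst hi
      by_cases hj : j ∈ J
      -- `J` holds the coordinates of row `i` read so far and `a` their values. A repeated query has
      -- a forced answer, and `J` does not grow.
      · have key : ∀ x : Str n, (∀ j ∈ J, x j = a j) →
            J ∪ (query i' j t₀ t₁).rowQueries (Function.update M i' x) i' =
              J ∪ (if a j then t₁ else t₀).rowQueries (Function.update M i' x) i' := by
          intro x hx
          have hJj : J ∪ {j} = J := by simpa using hj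
          simp only [rowQueries, if_true, Function.update_self, hx j hj, ← Finset.union_assoc, hJj]
          split_ifs <;> rfl
        have e1 : ∀ Q : Str n → Finset (Fin n) → Prop, ∀ x : Str n, ((∀ j ∈ J, x j = a j) ∧
            Q x (J ∪ (query i' j t₀ t₁).rowQueries (Function.update M i' x) i')) ↔
            ((∀ j ∈ J, x j = a j) ∧
              Q x (J ∪ (if a j then t₁ else t₀).rowQueries (Function.update M i' x) i')) := by
          intro Q x
          refine and_congr_right fun hx => ?_
          rw [key x hx]
        simp only [e1 fun x S => k < S.card ∧ x ∉ X, e1 fun x S => k < S.card]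
        split_ifs
        · exact h₁ J hJ a
        · exact h₀ J hJ a
      · have hsub : ∀ x : Str n, J ∪
            (query i' j t₀ t₁).rowQueries (Function.update M i' x) i' =
            insert j J ∪ (if x j then t₁.rowQueries (Function.update M i' x) i'
              else t₀.rowQueries (Function.update M i' x) i') := by
          intro x
          simp only [rowQueries, if_true, Function.update_self, ← Finset.union_assoc]
          congr 1
          ext y; simp
        simp only [hsub]
        -- If `J` is full, this query makes the row deep for every `x`, and the hypothesis on `k`
        -- prescribed bits applies directly. Otherwise both answers are followed with the larger
        -- set, and the two bounds add up.
        rcases hJ.eq_or_lt with hk | hk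
        · have hdeep : ∀ x : Str n, k < (insert j J ∪
              (if x j then t₁.rowQueries (Function.update M i' x) i'
                else t₀.rowQueries (Function.update M i' x) i')).card := by
            intro x
            refine lt_of_lt_of_le ?_ (Finset.card_le_card Finset.subset_union_left)
            rw [Finset.card_insert_of_notMem hj]; omega
          simp only [hdeep, true_and, and_true]
          exact hp J hk a
        · have hJ' : (insert j J).card ≤ k := by
            rw [Finset.card_insert_of_notMem hj]; omega
          have split : ∀ (Q : Str n → Finset (Fin n) → Prop) [∀ x S, Decidable (Q x S)],
              ∑ x with (∀ j ∈ J, x j = a j) ∧ Q x (insert j J ∪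
                (if x j then t₁.rowQueries (Function.update M i' x) i'
                else t₀.rowQueries (Function.update M i' x) i')), p x =
              (∑ x with (∀ j' ∈ insert j J, x j' = Function.update a j true j') ∧
                Q x (insert j J ∪ t₁.rowQueries (Function.update M i' x) i'), p x) +
              ∑ x with (∀ j' ∈ insert j J, x j' = Function.update a j false j') ∧
                Q x (insert j J ∪ t₀.rowQueries (Function.update M i' x) i'), p x := by
            intro Q _
            have hu : ∀ (x : Str n) (b : Bool),
                (∀ j' ∈ insert j J, x j' = Function.update a j b j') ↔
                  x j = b ∧ ∀ j' ∈ J, x j' = a j' := by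
              intro x b
              rw [Finset.forall_mem_insert]
              refine and_congr (by simp) (forall₂_congr fun j' hj' => ?_)
              rw [Function.update_of_ne]
              rintro rfl
              exact hj hj'
            rw [← Finset.sum_filter_add_sum_filter_not _ (fun x : Str n => x j = true)]
            simp only [Finset.filter_filter, hu]
            congr 1
            · refine Finset.sum_congr (Finset.filter_congr fun x _ => ?_) fun _ _ => rfl
              cases hx : x j <;> simp
            · refine Finset.sum_congr (Finset.filter_congr fun x _ => ?_) fun _ _ => rfl
              cases hx : x j <;> simp
          rw [split fun x S => k < S.card ∧ x ∉ X, split fun x S => k < S.card, mul_add]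
          exact add_le_add (h₁ _ hJ' _) (h₀ _ hJ' _)
    -- Queries to other rows have answers independent of `x`, because those rows are fixed.
    · have key : ∀ x : Str n, (query i' j t₀ t₁).rowQueries (Function.update M i x) i =
          (if M i' j then t₁ else t₀).rowQueries (Function.update M i x) i := by
        intro x
        simp only [rowQueries, if_neg hi, Finset.empty_union, Function.update_of_ne hi]
        split_ifs <;> rfl
      simp only [key]
      split_ifs
      · exact h₁ J hJ a
      · exact h₀ J hJ a

/-- Fubini for row `i` against the rest. The `default` only fills the slot that `Function.update`
overwrites. -/
theorem sum_prod_split (p : Str n → ℝ≥0∞) (i : Fin s) (F : (Fin s → Str n) → Prop)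
    [DecidablePred F] :
    ∑ M with F M, ∏ l, p (M l) =
      ∑ N : {l // l ≠ i} → Str n, (∏ l, p (N l)) *
        ∑ x with F (Function.update ((Equiv.funSplitAt i (Str n)).symm (default, N)) i x), p x := by
  rw [Finset.sum_filter, ← (Equiv.funSplitAt i (Str n)).symm.sum_comp, Fintype.sum_prod_type_right]
  refine Finset.sum_congr rfl fun N _ => ?_
  rw [Finset.mul_sum, Finset.sum_filter]
  refine Finset.sum_congr rfl fun x _ => ?_
  have h1 : Function.update ((Equiv.funSplitAt i (Str n)).symm (default, N)) i x =
      (Equiv.funSplitAt i (Str n)).symm (x, N) := by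
    funext l
    by_cases hl : l = i
    · subst hl; simp [Equiv.funSplitAt, Equiv.piSplitAt]
    · simp [Equiv.funSplitAt, Equiv.piSplitAt, hl]
  rw [h1]
  refine if_congr Iff.rfl ?_ rfl
  rw [Fintype.prod_eq_mul_prod_subtype_ne _ i, mul_comm]
  congr 1
  · refine Finset.prod_congr rfl fun l _ => ?_
    simp [Equiv.funSplitAt, Equiv.piSplitAt, l.2]
  · simp [Equiv.funSplitAt, Equiv.piSplitAt]

theorem sum_deep_notMem_le (p : Str n → ℝ≥0∞) (X : Finset (Str n)) (η : ℝ≥0∞) (k : ℕ)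
    (hp : ∀ J : Finset (Fin n), J.card = k → ∀ a : Str n,
      ∑ x with (∀ j ∈ J, x j = a j) ∧ x ∉ X, p x ≤ η * ∑ x with ∀ j ∈ J, x j = a j, p x)
    (i : Fin s) (t : DecisionTree s n) :
    ∑ M with k < (t.rowQueries M i).card ∧ M i ∉ X, ∏ l, p (M l) ≤
      η * ∑ M with k < (t.rowQueries M i).card, ∏ l, p (M l) := by
  rw [sum_prod_split p i, sum_prod_split p i, Finset.mul_sum]
  refine Finset.sum_le_sum fun N _ => ?_
  rw [mul_left_comm]
  gcongr
  -- At the root nothing has been read, so `J` is empty and the pattern is immaterial.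
  have := sum_notMem_le_of_prefix p X η k hp i
    ((Equiv.funSplitAt i (Str n)).symm (default, N)) t ∅ (by simp) default
  simp only [Finset.notMem_empty, false_imp_iff, implies_true, true_and,
    Finset.empty_union] at this
  simp only [Function.update_self]
  exact this

/-- Each deep row uses at least `k + 1` queries, so the number of deep rows times `k + 1` never
exceeds the height. -/
theorem sum_deep_notMem_mul_le (p : Str n → ℝ≥0∞) (hp1 : ∑ x, p x = 1) (X : Finset (Str n))
    (η : ℝ≥0∞) (k : ℕ)
    (hp : ∀ J : Finset (Fin n), J.card = k → ∀ a : Str n,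
      ∑ x with (∀ j ∈ J, x j = a j) ∧ x ∉ X, p x ≤ η * ∑ x with ∀ j ∈ J, x j = a j, p x)
    (t : DecisionTree s n) :
    (∑ i, ∑ M with k < (t.rowQueries M i).card ∧ M i ∉ X, ∏ l, p (M l)) * ((k + 1 : ℕ) : ℝ≥0∞) ≤
      η * t.height := by
  have htot : ∑ M : Fin s → Str n, ∏ l, p (M l) = 1 := by
    rw [← Fintype.prod_sum (fun (_ : Fin s) x => p x)]
    simp [hp1]
  calc (∑ i, ∑ M with k < (t.rowQueries M i).card ∧ M i ∉ X, ∏ l, p (M l)) * ((k + 1 : ℕ) : ℝ≥0∞)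
      ≤ (∑ i, η * ∑ M with k < (t.rowQueries M i).card, ∏ l, p (M l)) * ((k + 1 : ℕ) : ℝ≥0∞) := by
        gcongr with i
        exact sum_deep_notMem_le p X η k hp i t
    _ = η * ∑ M : Fin s → Str n, (∏ l, p (M l)) *
          ∑ i, (if k < (t.rowQueries M i).card then ((k + 1 : ℕ) : ℝ≥0∞) else 0) := by
        rw [← Finset.mul_sum, mul_assoc, Finset.sum_mul]
        congr 1
        simp only [Finset.mul_sum, Finset.sum_mul, Finset.sum_filter]
        rw [Finset.sum_comm]
        refine Finset.sum_congr rfl fun M _ => Finset.sum_congr rfl fun i _ => ?_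
        split_ifs <;> simp
    _ ≤ η * ∑ M : Fin s → Str n, (∏ l, p (M l)) * (t.height : ℝ≥0∞) := by
        gcongr with M
        calc ∑ i, (if k < (t.rowQueries M i).card then ((k + 1 : ℕ) : ℝ≥0∞) else 0)
            ≤ ∑ i, ((t.rowQueries M i).card : ℝ≥0∞) := by
              refine Finset.sum_le_sum fun i _ => ?_
              split_ifs with h
              · exact_mod_cast h
              · simp
          _ ≤ t.height := by exact_mod_cast sum_card_rowQueries_le M t
    _ = η * t.height := by rw [← Finset.sum_mul, htot, one_mul]

/-- A tree that accepts all inputs with at most `m` different rows accepts every input with few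
rows outside `X` that receive more than `k` queries, provided that every pattern on at most `k`
bits occurs in `X`. -/
theorem le_card_deep_of_eval_eq_false {m R k : ℕ} (t : DecisionTree s n)
    (ht : ∀ M : Fin s → Str n, (Finset.univ.image M).card ≤ m → t.eval M = true)
    (X : Finset (Str n)) (hXm : X.card + R ≤ m + 1)
    (hX : ∀ J : Finset (Fin n), J.card ≤ k → ∀ a : Str n, ∃ x ∈ X, ∀ j ∈ J, x j = a j)
    (M : Fin s → Str n) (hM : t.eval M = false) :
    R ≤ (Finset.univ.filter fun i => k < (t.rowQueries M i).card ∧ M i ∉ X).card := by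
  by_contra! hlt
  set D := Finset.univ.filter fun i => k < (t.rowQueries M i).card ∧ M i ∉ X with hD
  -- Deep rows stay as they are; shallow rows move into `X` without changing any bit that was read.
  -- The new matrix has at most `X.card + (R - 1)` distinct rows and the tree cannot tell it apart
  -- from `M`.
  have hrow : ∀ i, ∃ y : Str n, (y ∈ X ∨ y ∈ D.image M) ∧ ∀ j ∈ t.rowQueries M i, M i j = y j := by
    intro i
    by_cases hdeep : k < (t.rowQueries M i).card
    · refine ⟨M i, ?_, fun _ _ => rfl⟩
      by_cases hi : M i ∈ X
      · exact Or.inl hi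
      · exact Or.inr (Finset.mem_image_of_mem _ (by simp [hD, hdeep, hi]))
    · obtain ⟨x, hx, hxa⟩ := hX (t.rowQueries M i) (not_lt.1 hdeep) (M i)
      exact ⟨x, Or.inl hx, fun j hj => (hxa j hj).symm⟩
  choose M' hM'X hM' using hrow
  have hcard : (Finset.univ.image M').card ≤ m := by
    have hsub : Finset.univ.image M' ⊆ X ∪ D.image M := by
      intro y hy
      obtain ⟨i, -, rfl⟩ := Finset.mem_image.1 hy
      exact Finset.mem_union.2 (hM'X i)
    have h1 := Finset.card_le_card hsub
    have h2 := Finset.card_union_le X (D.image M)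
    have h3 : (D.image M).card ≤ D.card := Finset.card_image_le
    omega
  have := ht M' hcard
  rw [← eval_congr t hM', hM] at this
  exact Bool.false_ne_true this

/-- Markov's inequality for the number of deep rows outside `X`, which is at least `R` on every
rejected input. -/
theorem sum_reject_mul_le {m R k : ℕ} (p : Str n → ℝ≥0∞) (hp1 : ∑ x, p x = 1)
    (X : Finset (Str n)) (η : ℝ≥0∞)
    (hp : ∀ J : Finset (Fin n), J.card = k → ∀ a : Str n,
      ∑ x with (∀ j ∈ J, x j = a j) ∧ x ∉ X, p x ≤ η * ∑ x with ∀ j ∈ J, x j = a j, p x)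
    (hXm : X.card + R ≤ m + 1)
    (hX : ∀ J : Finset (Fin n), J.card ≤ k → ∀ a : Str n, ∃ x ∈ X, ∀ j ∈ J, x j = a j)
    (t : DecisionTree s n)
    (ht : ∀ M : Fin s → Str n, (Finset.univ.image M).card ≤ m → t.eval M = true) :
    (∑ M with t.eval M = false, ∏ l, p (M l)) * (R * (k + 1 : ℕ) : ℝ≥0∞) ≤ η * t.height := by
  refine le_trans ?_ (sum_deep_notMem_mul_le p hp1 X η k hp t)
  rw [← mul_assoc]
  gcongr
  simp only [Finset.sum_filter]
  rw [Finset.sum_comm, Finset.sum_mul]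
  refine Finset.sum_le_sum fun M _ => ?_
  split_ifs with hM
  · have h := le_card_deep_of_eval_eq_false t ht X hXm hX M hM
    rw [← Finset.sum_filter, Finset.sum_const, nsmul_eq_mul, mul_comm]
    gcongr
  · simp

end DecisionTree

/-! ### From one-sided tests to trees. -/

/-- One-sidedness forces every tree to accept all inputs with at most `m` different rows. -/
theorem IsOneSidedTest.eval_eq_true {s n m : ℕ} {ε : ℝ} {A : RandAlg s n} (hm : 0 < m)
    (hA : IsOneSidedTest A ε (boundedSupport m n)) {t : DecisionTree s n} (ht : t ∈ A.support)
    (M : Fin s → Str n) (hM : (Finset.univ.image M).card ≤ m) : t.eval M = true := by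
  classical
  -- The uniform distribution on the rows of `M` has the property and produces `M` with positive
  -- probability. A singleton stands in when there are no samples.
  obtain ⟨Y, hMY, hY, hYm⟩ : ∃ Y : Finset (Str n),
      Finset.univ.image M ⊆ Y ∧ Y.Nonempty ∧ Y.card ≤ m := by
    rcases (Finset.univ.image M).eq_empty_or_nonempty with h | h
    · exact ⟨{default}, by simp [h], by simp, by simpa using Nat.succ_le_of_lt hm⟩
    · exact ⟨_, subset_rfl, h, hM⟩
  set Q : PMF (Str n) := PMF.uniformOfFinset Y hY with hQ
  have hQm : Q ∈ boundedSupport m n := by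
    simpa [boundedSupport, hQ] using hYm
  have h1 := hA.2 Q hQm
  have hMs : M ∈ (iidSamples s Q).support := by
    rw [PMF.mem_support_iff, iidSamples, PMF.ofFintype_apply, Finset.prod_ne_zero_iff]
    intro i _
    rw [← PMF.mem_support_iff, hQ, PMF.mem_support_uniformOfFinset_iff]
    exact hMY (Finset.mem_image_of_mem _ (Finset.mem_univ i))
  rw [PMF.apply_eq_one_iff] at h1
  have h2 : t.eval M ∈ (A.output Q).support := by
    rw [RandAlg.output, PMF.mem_support_bind_iff]
    exact ⟨t, ht, (PMF.mem_support_map_iff _ _ _).2 ⟨M, hMs, rfl⟩⟩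
  rw [h1] at h2
  exact h2

theorem iidSamples_map {s n n' : ℕ} (e : Str n → Str n') (P : PMF (Str n)) :
    iidSamples s (P.map e) = (iidSamples s P).map fun M i => e (M i) := by
  classical
  ext M
  simp only [iidSamples, PMF.ofFintype_apply, PMF.map_apply, tsum_fintype]
  rw [Fintype.prod_sum]
  refine Finset.sum_congr rfl fun N _ => ?_
  by_cases h : ∀ i, M i = e (N i)
  · have : M = fun i => e (N i) := funext h
    simp [this]
  · rw [if_neg fun h' => h fun i => congrFun h' i]
    push Not at h
    obtain ⟨i, hi⟩ := h
    exact Finset.prod_eq_zero (Finset.mem_univ i) (if_neg hi)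

/-- Lower bound on the number of queries from a hard distribution, whose strings of length `n`
are pulled back to length `n'` along `b`. -/
theorem IsOneSidedTest.rejection_mul_le {s n n' m R k q : ℕ} {ε : ℝ} {A : RandAlg s n'}
    (hm : 0 < m) (hA : IsOneSidedTest A ε (boundedSupport m n')) (hAq : A.MakesAtMost q)
    (b : Fin n' → Fin n) (P : PMF (Str n)) (X : Finset (Str n)) (η : ℝ≥0∞)
    (hp : ∀ J : Finset (Fin n), J.card = k → ∀ a : Str n,
      ∑ x with (∀ j ∈ J, x j = a j) ∧ x ∉ X, P x ≤ η * ∑ x with ∀ j ∈ J, x j = a j, P x)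
    (hXm : X.card + R ≤ m + 1)
    (hX : ∀ J : Finset (Fin n), J.card ≤ k → ∀ a : Str n, ∃ x ∈ X, ∀ j ∈ J, x j = a j) :
    A.output (P.map fun x => x ∘ b) false * (R * (k + 1 : ℕ) : ℝ≥0∞) ≤ η * q := by
  have hP1 : ∑ x, P x = 1 := by rw [← tsum_fintype (L := .unconditional _)]; exact P.tsum_coe
  rw [RandAlg.output, PMF.bind_apply, ← ENNReal.tsum_mul_right]
  have hbound : ∀ t : DecisionTree s n', A t * ((iidSamples s (P.map fun x => x ∘ b)).map
      fun M => t.eval M) false * (R * (k + 1 : ℕ) : ℝ≥0∞) ≤ A t * (η * q) := by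
    intro t
    by_cases ht : t ∈ A.support
    swap
    · rw [PMF.mem_support_iff, not_not] at ht
      simp [ht]
    rw [mul_assoc]
    refine mul_le_mul' le_rfl ?_
    have hacc : ∀ M : Fin s → Str n, (Finset.univ.image M).card ≤ m →
        (t.relabel b).eval M = true := by
      intro M hM
      rw [DecisionTree.eval_relabel]
      refine hA.eval_eq_true hm ht _ (le_trans ?_ hM)
      have : (Finset.univ.image fun i j => M i (b j)) =
          (Finset.univ.image M).image fun x : Str n => x ∘ b := by
        rw [Finset.image_image]; rfl
      rw [this]
      exact Finset.card_image_le
    have hmain := DecisionTree.sum_reject_mul_le P hP1 X η hp hXm hX (t.relabel b) hacc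
    have hsum : ((iidSamples s (P.map fun x => x ∘ b)).map fun M => t.eval M) false =
        ∑ M with (t.relabel b).eval M = false, ∏ l, P (M l) := by
      rw [iidSamples_map, PMF.map_comp, PMF.map_apply, tsum_fintype, Finset.sum_filter]
      refine Finset.sum_congr rfl fun M _ => ?_
      rw [DecisionTree.eval_relabel]
      simp only [iidSamples, PMF.ofFintype_apply, Function.comp_def]
      by_cases h : t.eval (fun i j => M i (b j)) = false
      · rw [if_pos h, if_pos h.symm]
      · rw [if_neg h, if_neg (Ne.symm h)]
    rw [hsum]
    refine hmain.trans ?_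
    rw [DecisionTree.height_relabel]
    gcongr
    exact hAq t ht
  calc _ ≤ ∑' t, A t * (η * q) := ENNReal.tsum_le_tsum hbound
    _ = η * q := by rw [ENNReal.tsum_mul_right, A.tsum_coe, one_mul]

/-! ### A small-support distribution with uniform marginals on few coordinates. -/

theorem card_fiber_mul_card {G H : Type*} [AddGroup G] [Fintype G] [AddGroup H] [Fintype H]
    [DecidableEq H] (f : G →+ H) (hf : Function.Surjective f) (h : H) :
    (Finset.univ.filter fun g => f g = h).card * Fintype.card H = Fintype.card G := by
  rw [← Finset.card_univ (α := G), Finset.card_eq_sum_card_fiberwise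
    (s := Finset.univ) (f := f) (t := Finset.univ) (by simp), Finset.sum_congr rfl fun y _ =>
      AddMonoidHom.card_fiber_eq_of_mem_range f (hf y) (hf h)]
  simp [mul_comm]

/-- The number of sets of size at most `k` in a set of size `32 K`. -/
theorem card_small_subsets_le (k K : ℕ) :
    (Finset.univ.filter fun S : Finset (Fin (32 * K)) => S.card ≤ k).card ≤ 32 ^ k * 4 ^ K := by
  -- Weighting `S` by `(1 / 32) ^ S.card` gives total `(1 + 1 / 32) ^ (32 * K) ≤ 4 ^ K`, and each
  -- counted set weighs at least `(1 / 32) ^ k`.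
  have h1 := Fintype.sum_pow_mul_eq_add_pow (Fin (32 * K)) (1 / 32 : ℝ) 1
  simp only [one_pow, mul_one, Fintype.card_fin] at h1
  have h2 : ((Finset.univ.filter fun S : Finset (Fin (32 * K)) => S.card ≤ k).card : ℝ) *
      (1 / 32) ^ k ≤ (1 / 32 + 1) ^ (32 * K) := by
    rw [← h1, ← nsmul_eq_mul, ← Finset.sum_const]
    refine (Finset.sum_le_sum fun S hS => ?_).trans
      (Finset.sum_le_univ_sum_of_nonneg fun S => by positivity)
    exact pow_le_pow_of_le_one (by norm_num) (by norm_num) (Finset.mem_filter.1 hS).2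
  have h3 : (1 / 32 + 1 : ℝ) ^ (32 * K) ≤ 4 ^ K := by
    rw [pow_mul]
    gcongr
    norm_num
  have h4 : ((Finset.univ.filter fun S : Finset (Fin (32 * K)) => S.card ≤ k).card : ℝ) ≤
      32 ^ k * 4 ^ K := by
    have := h2.trans h3
    rw [one_div, inv_pow, ← div_eq_mul_inv, div_le_iff₀ (by positivity)] at this
    linarith
  exact_mod_cast h4

/-- Gilbert–Varshamov: there are `n` vectors in `𝔽₂ᵗ` none of whose nonempty sums over at most `k`
indices vanishes, as long as there are fewer than `2 ^ t` such index sets. -/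
theorem exists_sum_ne_zero (n t k : ℕ)
    (h : (Finset.univ.filter fun S : Finset (Fin n) => S.Nonempty ∧ S.card ≤ k).card < 2 ^ t) :
    ∃ v : Fin n → Fin t → ZMod 2, ∀ S : Finset (Fin n), S.Nonempty → S.card ≤ k →
      ∑ j ∈ S, v j ≠ 0 := by
  classical
  by_contra! hcon
  set F := Finset.univ.filter fun S : Finset (Fin n) => S.Nonempty ∧ S.card ≤ k
  -- Union bound: a fixed nonempty sum vanishes for exactly a `2 ^ (-t)` fraction of the families
  -- `v`.
  have hcover : (Finset.univ : Finset (Fin n → Fin t → ZMod 2)) ⊆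
      F.biUnion fun S => Finset.univ.filter fun v => ∑ j ∈ S, v j = 0 := by
    intro v _
    obtain ⟨S, hS, hSk, hv⟩ := hcon v
    simp only [Finset.mem_biUnion, Finset.mem_filter, Finset.mem_univ, true_and, F]
    exact ⟨S, ⟨hS, hSk⟩, hv⟩
  have hcard : ∀ S ∈ F, (Finset.univ.filter fun v : Fin n → Fin t → ZMod 2 =>
      ∑ j ∈ S, v j = 0).card * 2 ^ t = Fintype.card (Fin n → Fin t → ZMod 2) := by
    intro S hS
    obtain ⟨j₀, hj₀⟩ := (Finset.mem_filter.1 hS).2.1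
    let f : (Fin n → Fin t → ZMod 2) →+ (Fin t → ZMod 2) := ∑ j ∈ S, Pi.evalAddMonoidHom _ j
    have hfv : ∀ v, f v = ∑ j ∈ S, v j := by
      intro v
      simp [f, AddMonoidHom.finsetSum_apply]
    have hf : Function.Surjective f := by
      intro y
      refine ⟨Pi.single j₀ y, ?_⟩
      rw [hfv, Finset.sum_eq_single j₀]
      · simp
      · intro j _ hj
        simp [hj]
      · exact fun h => (h hj₀).elim
    have := card_fiber_mul_card f hf 0
    simp only [hfv] at this
    simpa [ZMod.card] using this
  have h1 := Finset.card_le_card hcover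
  have h2 := h1.trans Finset.card_biUnion_le
  have h3 : Fintype.card (Fin n → Fin t → ZMod 2) * 2 ^ t ≤
      F.card * Fintype.card (Fin n → Fin t → ZMod 2) := by
    rw [← Finset.card_univ]
    refine (Nat.mul_le_mul_right _ h2).trans ?_
    rw [Finset.sum_mul, Finset.sum_congr rfl hcard, Finset.sum_const, smul_eq_mul,
      Finset.card_univ]
  have h4 : 0 < Fintype.card (Fin n → Fin t → ZMod 2) := Fintype.card_pos
  rw [mul_comm] at h3
  exact absurd (Nat.le_of_mul_le_mul_right h3 h4) (not_le.2 h)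

/-- The string of parities of a vector with the vectors `v j`. -/
def parityString {n t : ℕ} (v : Fin n → Fin t → ZMod 2) (u : Fin t → ZMod 2) : Str n :=
  fun j => decide (v j ⬝ᵥ u = 1)

/-- Over `ZMod 2` a linear relation is a vanishing subset sum, so the `v j` with `j ∈ J` are
independent. Hence `u ↦ (v j ⬝ᵥ u)` is onto, with fibres of equal size. -/
theorem card_parityString_agree {n t k : ℕ} (v : Fin n → Fin t → ZMod 2)
    (hv : ∀ S : Finset (Fin n), S.Nonempty → S.card ≤ k → ∑ j ∈ S, v j ≠ 0)
    (J : Finset (Fin n)) (hJ : J.card ≤ k) (a : Str n) :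
    (Finset.univ.filter fun u => ∀ j ∈ J, parityString v u j = a j).card * 2 ^ J.card = 2 ^ t := by
  classical
  have hlin : LinearIndependent (ZMod 2) fun j : J => v j := by
    rw [Fintype.linearIndependent_iff]
    intro g hg
    by_contra! hne
    obtain ⟨i, hi⟩ := hne
    set S : Finset (Fin n) := (Finset.univ.filter fun j : J => g j ≠ 0).image Subtype.val with hS
    refine hv S ⟨i, ?_⟩ ?_ ?_
    · simp only [hS, Finset.mem_image, Finset.mem_filter, Finset.mem_univ, true_and]
      exact ⟨i, hi, rfl⟩
    · refine le_trans (Finset.card_le_card ?_) hJ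
      intro j hj
      obtain ⟨j', -, rfl⟩ := Finset.mem_image.1 hj
      exact j'.2
    · rw [hS, Finset.sum_image (by simp), Finset.sum_filter]
      refine Eq.trans ?_ hg
      refine Finset.sum_congr rfl fun j _ => ?_
      have h01 : ∀ z : ZMod 2, z ≠ 0 → z = 1 := by decide
      split_ifs with h
      · rw [h01 _ h, one_smul]
      · rw [not_not.1 h, zero_smul]
  let B : Matrix J (Fin t) (ZMod 2) := Matrix.of fun j => v j
  have hB : Function.Surjective B.mulVecLin := by
    rw [← LinearMap.range_eq_top]
    apply Submodule.eq_top_of_finrank_eq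
    have : B.rank = Fintype.card J := LinearIndependent.rank_matrix hlin
    rw [← Matrix.rank, this]
    simp
  let y : J → ZMod 2 := fun j => if a j then 1 else 0
  have hfib := card_fiber_mul_card B.mulVecLin.toAddMonoidHom hB y
  simp only [Fintype.card_fun, ZMod.card, Fintype.card_coe, Fintype.card_fin] at hfib
  rw [← hfib]
  congr 2
  ext u
  simp only [Finset.mem_filter, Finset.mem_univ, true_and]
  have hmul : ∀ j : J, B.mulVecLin.toAddMonoidHom u j = v j ⬝ᵥ u := fun j => rfl
  rw [funext_iff]
  simp only [hmul, Subtype.forall, y, parityString]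
  have h01 : ∀ z : ZMod 2, ∀ b : Bool, decide (z = 1) = b ↔ z = if b then 1 else 0 := by decide
  exact forall₂_congr fun j _ => h01 _ _

theorem exists_heavy (k : ℕ) : ∃ h : PMF (Str (32 * (k + 1))),
    h.support.ncard ≤ 2 ^ (10 * k) ∧
    ∀ J : Finset (Fin (32 * (k + 1))), J.card ≤ k → ∀ a : Str (32 * (k + 1)),
      ∑ x with ∀ j ∈ J, x j = a j, h x = (2 ^ J.card : ℝ≥0∞)⁻¹ := by
  classical
  have hcount : (Finset.univ.filter fun S : Finset (Fin (32 * (k + 1))) =>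
      S.Nonempty ∧ S.card ≤ k).card < 2 ^ (10 * k) := by
    -- The estimate `2 ^ (7 * k + 2) < 2 ^ (10 * k)` fails at `k = 0`, where there are no sets to
    -- count.
    rcases k.eq_zero_or_pos with rfl | hk
    · rw [Finset.card_eq_zero.2]
      · simp
      · ext S
        simp only [Finset.mem_filter, Finset.mem_univ, true_and, Finset.notMem_empty, iff_false]
        rintro ⟨h1, h2⟩
        have := h1.card_pos
        omega
    · refine lt_of_le_of_lt (Finset.card_le_card fun S hS => ?_)
        (lt_of_le_of_lt (card_small_subsets_le k (k + 1)) ?_)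
      · simp only [Finset.mem_filter, Finset.mem_univ, true_and] at hS ⊢
        exact hS.2
      · have e1 : 32 ^ k * 4 ^ (k + 1) = 2 ^ (7 * k + 2) := by
          rw [show (32 : ℕ) = 2 ^ 5 by norm_num, show (4 : ℕ) = 2 ^ 2 by norm_num, ← pow_mul,
            ← pow_mul, ← pow_add]
          congr 1
          ring
        rw [e1]
        exact Nat.pow_lt_pow_right (by norm_num) (by omega)
  obtain ⟨v, hv⟩ := exists_sum_ne_zero _ _ _ hcount
  refine ⟨(PMF.uniformOfFintype (Fin (10 * k) → ZMod 2)).map (parityString v), ?_, ?_⟩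
  · rw [PMF.support_map, PMF.support_uniformOfFintype]
    refine (Set.ncard_image_le (Set.toFinite _)).trans ?_
    simp [Set.ncard_univ]
  · intro J hJ a
    have h1 := card_parityString_agree v hv J hJ a
    set c := (Finset.univ.filter fun u => ∀ j ∈ J, parityString v u j = a j).card with hc
    have h2 : ∑ x with ∀ j ∈ J, x j = a j,
        (PMF.uniformOfFintype (Fin (10 * k) → ZMod 2)).map (parityString v) x =
        c * (2 ^ (10 * k) : ℝ≥0∞)⁻¹ := by
      simp only [PMF.map_apply, tsum_fintype, PMF.uniformOfFintype_apply]
      rw [Finset.sum_comm, hc, ← nsmul_eq_mul, ← Finset.sum_const, Finset.sum_filter]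
      refine Finset.sum_congr rfl fun u _ => ?_
      rw [Finset.sum_ite_eq']
      simp
    rw [h2]
    have h3 : (2 ^ (10 * k) : ℝ≥0∞) = c * 2 ^ J.card := by exact_mod_cast h1.symm
    have hc0 : (c : ℝ≥0∞) ≠ 0 := by
      rintro h0
      rw [h0, zero_mul] at h3
      exact pow_ne_zero _ two_ne_zero h3
    rw [h3, ENNReal.mul_inv (Or.inl hc0) (Or.inl (ENNReal.natCast_ne_top c)), ← mul_assoc,
      ENNReal.mul_inv_cancel hc0 (ENNReal.natCast_ne_top c), one_mul]

/-! ### The hard mixture. -/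

theorem sum_uniform_agree {n : ℕ} (J : Finset (Fin n)) (a : Str n) :
    ∑ x with ∀ j ∈ J, x j = a j, PMF.uniformOfFintype (Str n) x = (2 ^ J.card : ℝ≥0∞)⁻¹ := by
  classical
  have h1 : (Finset.univ.filter fun x : Str n => ∀ j ∈ J, x j = a j) =
      Fintype.piFinset fun j => if j ∈ J then {a j} else Finset.univ := by
    ext x
    simp only [Finset.mem_filter, Finset.mem_univ, true_and, Fintype.mem_piFinset]
    refine forall_congr' fun j => ?_
    split_ifs with h <;> simp [h]
  have h2 : (Finset.univ.filter fun x : Str n => ∀ j ∈ J, x j = a j).card * 2 ^ J.card = 2 ^ n := by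
    rw [h1, Fintype.card_piFinset, Finset.prod_congr rfl fun j _ => apply_ite Finset.card _ _ _]
    simp only [Finset.card_singleton, Finset.card_univ, Fintype.card_bool, Finset.prod_ite,
      Finset.prod_const, one_pow, one_mul]
    rw [← pow_add, Finset.filter_not, Finset.card_sdiff_of_subset (Finset.filter_subset _ _)]
    simp only [Finset.filter_mem_eq_inter, Finset.univ_inter, Finset.card_univ, Fintype.card_fin]
    rw [Nat.sub_add_cancel (by simpa using Finset.card_le_univ J)]
  simp only [PMF.uniformOfFintype_apply, Finset.sum_const, nsmul_eq_mul]
  set c := (Finset.univ.filter fun x : Str n => ∀ j ∈ J, x j = a j).card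
  have h3 : (Fintype.card (Str n) : ℝ≥0∞) = c * 2 ^ J.card := by
    simp only [Fintype.card_fun, Fintype.card_bool, Fintype.card_fin]
    exact_mod_cast h2.symm
  have hc0 : (c : ℝ≥0∞) ≠ 0 := by
    rintro h0
    rw [h0, zero_mul] at h3
    simp at h3
  rw [h3, ENNReal.mul_inv (Or.inl hc0) (Or.inl (ENNReal.natCast_ne_top c)), ← mul_assoc,
    ENNReal.mul_inv_cancel hc0 (ENNReal.natCast_ne_top c), one_mul]

theorem sum_pmf_eq_one {α : Type*} [Fintype α] (P : PMF α) : ∑ x, P x = 1 := by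
  rw [← tsum_fintype (L := .unconditional _)]; exact P.tsum_coe

/-- The mixture of `h`, with weight `1 - η`, and the uniform distribution, with weight `η`. -/
noncomputable def uniformMixture {n : ℕ} (h : PMF (Str n)) (η : ℝ≥0∞) (hη : η ≤ 1) :
    PMF (Str n) :=
  PMF.ofFintype (fun x => (1 - η) * h x + η * PMF.uniformOfFintype (Str n) x) <| by
    rw [Finset.sum_add_distrib, ← Finset.mul_sum, ← Finset.mul_sum, sum_pmf_eq_one, sum_pmf_eq_one,
      mul_one, mul_one, tsub_add_cancel_of_le hη]

/-- Both components give the pattern on `J` the same mass, so seeing it leaves their weights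
unchanged; outside `X` only the uniform component contributes. -/
theorem uniformMixture_agree_notMem_le {n : ℕ} (h : PMF (Str n)) (η : ℝ≥0∞) (hη : η ≤ 1)
    (X : Finset (Str n)) (hX : ∀ x ∉ X, h x = 0) (J : Finset (Fin n)) (a : Str n)
    (hJ : ∑ x with ∀ j ∈ J, x j = a j, h x = (2 ^ J.card : ℝ≥0∞)⁻¹) :
    ∑ x with (∀ j ∈ J, x j = a j) ∧ x ∉ X, uniformMixture h η hη x ≤
      η * ∑ x with ∀ j ∈ J, x j = a j, uniformMixture h η hη x := by
  have h1 : ∑ x with ∀ j ∈ J, x j = a j, uniformMixture h η hη x = (2 ^ J.card : ℝ≥0∞)⁻¹ := by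
    simp only [uniformMixture, PMF.ofFintype_apply]
    rw [Finset.sum_add_distrib, ← Finset.mul_sum, ← Finset.mul_sum, hJ, sum_uniform_agree,
      ← add_mul, tsub_add_cancel_of_le hη, one_mul]
  rw [h1, ← sum_uniform_agree J a, Finset.mul_sum]
  calc ∑ x with (∀ j ∈ J, x j = a j) ∧ x ∉ X, uniformMixture h η hη x
      = ∑ x with (∀ j ∈ J, x j = a j) ∧ x ∉ X, η * PMF.uniformOfFintype (Str n) x := by
        refine Finset.sum_congr rfl fun x hx => ?_
        simp [uniformMixture, hX x (Finset.mem_filter.1 hx).2.2]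
    _ ≤ ∑ x with ∀ j ∈ J, x j = a j, η * PMF.uniformOfFintype (Str n) x := by
        refine Finset.sum_le_sum_of_subset fun x hx => ?_
        simp only [Finset.mem_filter, Finset.mem_univ, true_and] at hx ⊢
        exact hx.1

/-! ### Distance of the mixture from bounded support. -/

/-- The block of length `r` that contains a given position. -/
def block (n r : ℕ) (j : Fin (n * r)) : Fin n := (finProdFinEquiv.symm j).1

theorem hammingDist_comp_block {n r : ℕ} (x y : Str n) :
    hammingDist (x ∘ block n r) (y ∘ block n r) = hammingDist x y * r := by
  simp only [hammingDist, Finset.card_filter, Function.comp_apply]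
  rw [← finProdFinEquiv.sum_comp, Fintype.sum_prod_type]
  simp [block, Finset.sum_mul]

theorem comp_block_injective {n r : ℕ} (hr : 0 < r) :
    Function.Injective fun x : Str n => x ∘ block n r := by
  intro x y hxy
  have h := hammingDist_comp_block (r := r) x y
  rw [show x ∘ block n r = y ∘ block n r from hxy, hammingDist_self] at h
  exact hammingDist_eq_zero.1 ((Nat.mul_eq_zero.1 h.symm).resolve_right hr.ne')

/-- Two strings near the same `z` differ in at most `K` places, so difference sets with one of them
inject into the at most `32 ^ K * 4 ^ K` small subsets. -/
theorem card_near_le {K r : ℕ} (hr : 0 < r) (z : Str (32 * K * r)) :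
    (Finset.univ.filter fun x : Str (32 * K) =>
      2 * hammingDist (x ∘ block (32 * K) r) z ≤ K * r).card ≤ 2 ^ (7 * K) := by
  classical
  set N := Finset.univ.filter fun x : Str (32 * K) =>
      2 * hammingDist (x ∘ block (32 * K) r) z ≤ K * r with hN
  rcases N.eq_empty_or_nonempty with h | ⟨x₀, hx₀⟩
  · simp [h]
  have hclose : ∀ x ∈ N, hammingDist x x₀ ≤ K := by
    intro x hx
    simp only [hN, Finset.mem_filter, Finset.mem_univ, true_and] at hx hx₀
    have h1 := hammingDist_triangle_right (x ∘ block (32 * K) r) (x₀ ∘ block (32 * K) r) z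
    rw [hammingDist_comp_block] at h1
    refine Nat.le_of_mul_le_mul_right (c := r) ?_ hr
    omega
  have hcard : N.card ≤ (Finset.univ.filter fun S : Finset (Fin (32 * K)) => S.card ≤ K).card := by
    refine Finset.card_le_card_of_injOn (fun x => Finset.univ.filter fun j => x j ≠ x₀ j) ?_ ?_
    · intro x hx
      simpa [hammingDist] using hclose x hx
    · intro x _ y _ hxy
      funext j
      have h := Finset.ext_iff.1 hxy j
      simp only [Finset.mem_filter, Finset.mem_univ, true_and] at h
      revert h
      cases x j <;> cases y j <;> cases x₀ j <;> simp
  refine (hcard.trans (card_small_subsets_le K K)).trans (le_of_eq ?_)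
  rw [← mul_pow, pow_mul]
  norm_num

theorem le_distFrom_boundedSupport {m K r : ℕ} (hK : 0 < K) (hr : 0 < r) (hm : m ≤ 2 ^ (11 * K))
    (P : PMF (Str (32 * K))) (η : ℝ≥0∞)
    (hP : ∀ x, η * PMF.uniformOfFintype (Str (32 * K)) x ≤ P x) :
    η / 128 ≤ distFrom (P.map fun x => x ∘ block (32 * K) r)
      (boundedSupport m (32 * K * r)) := by
  classical
  set e : Str (32 * K) → Str (32 * K * r) := fun x => x ∘ block (32 * K) r with he
  refine le_iInf₂ fun Q hQ => le_iInf₂ fun T hT => ?_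
  set Z : Finset (Str (32 * K * r)) := Q.support.toFinset with hZ
  have hZm : Z.card ≤ m := by
    rw [hZ, ← Set.ncard_eq_toFinset_card']; exact hQ
  -- The strings within relative distance `1 / 64` of the support of `Q`: at most `2 ^ (11 * K + 7 *
  -- K)`, hence at most half of the cube.
  set N : Finset (Str (32 * K)) := Z.biUnion fun z => Finset.univ.filter fun x : Str (32 * K) =>
    2 * hammingDist (e x) z ≤ K * r with hN
  have hNcard : 2 * N.card ≤ 2 ^ (32 * K) := by
    have h1 : N.card ≤ m * 2 ^ (7 * K) :=
      (Finset.card_biUnion_le_card_mul _ _ _ fun z _ => card_near_le hr z).trans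
        (Nat.mul_le_mul_right _ hZm)
    calc 2 * N.card ≤ 2 * (2 ^ (11 * K) * 2 ^ (7 * K)) :=
          Nat.mul_le_mul_left _ (h1.trans (Nat.mul_le_mul_right _ hm))
      _ = 2 ^ (1 + (11 * K + 7 * K)) := by rw [pow_add, pow_add, pow_one]
      _ ≤ 2 ^ (32 * K) := Nat.pow_le_pow_right (by norm_num) (by omega)
  have hfarcard : 2 ^ (32 * K) ≤ 2 * Nᶜ.card := by
    have h1 := Finset.card_compl_add_card N
    simp only [Fintype.card_fun, Fintype.card_bool, Fintype.card_fin] at h1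
    omega
  have hmass : η / 2 ≤ ∑ u ∈ Nᶜ.image e, P.map e u := by
    rw [Finset.sum_image ((comp_block_injective hr).injOn)]
    calc η / 2 ≤ η * (Nᶜ.card * (2 ^ (32 * K) : ℝ≥0∞)⁻¹) := by
          rw [div_eq_mul_inv]
          gcongr
          rw [← div_eq_mul_inv, ENNReal.le_div_iff_mul_le (by simp) (by simp), mul_comm,
            ← div_eq_mul_inv]
          refine ENNReal.div_le_of_le_mul' ?_
          exact_mod_cast hfarcard
      _ = ∑ x ∈ Nᶜ, η * PMF.uniformOfFintype (Str (32 * K)) x := by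
          simp [PMF.uniformOfFintype_apply, mul_left_comm]
      _ ≤ ∑ x ∈ Nᶜ, P.map e (e x) := by
          refine Finset.sum_le_sum fun x _ => (hP x).trans ?_
          rw [PMF.map_apply, tsum_fintype]
          refine le_trans ?_ (Finset.single_le_sum (fun _ _ => zero_le) (Finset.mem_univ x))
          rw [if_pos rfl]
  have hcost : ∀ uv : Str (32 * K * r) × Str (32 * K * r), uv.1 ∈ Nᶜ.image e →
      T uv / 64 ≤ T uv * strDist uv.1 uv.2 := by
    rintro ⟨u, v⟩ huv
    obtain ⟨x, hx, rfl⟩ := Finset.mem_image.1 huv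
    by_cases hTz : T (e x, v) = 0
    · simp [hTz]
    have hvZ : v ∈ Z := by
      rw [hZ, Set.mem_toFinset, ← hT.2, PMF.mem_support_map_iff]
      exact ⟨(e x, v), hTz, rfl⟩
    rw [div_eq_mul_inv]
    gcongr
    have hfar : K * r < 2 * hammingDist (e x) v := by
      by_contra! hle
      refine Finset.mem_compl.1 hx ?_
      simp only [hN, Finset.mem_biUnion, Finset.mem_filter, Finset.mem_univ, true_and]
      exact ⟨v, hvZ, hle⟩
    have hpos : 32 * K * r ≠ 0 := by positivity
    simp only [strDist]
    rw [ENNReal.le_div_iff_mul_le (Or.inl (by exact_mod_cast hpos))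
      (Or.inl (ENNReal.natCast_ne_top _)), mul_comm, ← div_eq_mul_inv]
    refine ENNReal.div_le_of_le_mul' ?_
    have : 32 * K * r ≤ 64 * hammingDist (e x) v := by nlinarith
    exact_mod_cast this
  calc η / 128 = η / 2 / 64 := by
        rw [div_eq_mul_inv, div_eq_mul_inv, div_eq_mul_inv, mul_assoc,
          ← ENNReal.mul_inv (by simp) (by simp)]
        norm_num
    _ ≤ (∑ u ∈ Nᶜ.image e, P.map e u) / 64 := by gcongr
    _ = ∑ u ∈ Nᶜ.image e, ∑ v, T (u, v) / 64 := by
        rw [div_eq_mul_inv, Finset.sum_mul]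
        refine Finset.sum_congr rfl fun u _ => ?_
        rw [← hT.1, PMF.map_apply, tsum_fintype, Fintype.sum_prod_type, Finset.sum_eq_single u]
        · simp [Finset.sum_mul, div_eq_mul_inv]
        · intro u' _ hu'
          simp [hu'.symm]
        · simp
    _ ≤ ∑ u ∈ Nᶜ.image e, ∑ v, T (u, v) * strDist u v := by
        refine Finset.sum_le_sum fun u hu => Finset.sum_le_sum fun v _ => hcost (u, v) hu
    _ ≤ ∑ u, ∑ v, T (u, v) * strDist u v := Finset.sum_le_univ_sum_of_nonneg fun _ => zero_le
    _ = ∑ uv, T uv * strDist uv.1 uv.2 := by rw [Fintype.sum_prod_type]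

/-! ### Choice of parameters. -/

theorem IsOneSidedTest.mul_le_queries {m k r s q : ℕ} (hr : 0 < r)
    (hmlow : 2 ^ (10 * k) ≤ m / 2) (hmup : m ≤ 2 ^ (11 * (k + 1))) {ε : ℝ} (hε : 0 < ε)
    (hε' : ε < 1 / 256) {A : RandAlg s (32 * (k + 1) * r)}
    (hA : IsOneSidedTest A ε (boundedSupport m (32 * (k + 1) * r))) (hAq : A.MakesAtMost q) :
    (m : ℝ) * (k + 1) ≤ 768 * ε * q := by
  classical
  have hm0 : 0 < m := by
    have : 0 < 2 ^ (10 * k) := by positivity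
    omega
  obtain ⟨h, hsupp, hagree⟩ := exists_heavy k
  -- The distance bound `η / 128` becomes `2 * ε`, strictly above `ε`.
  set η : ℝ≥0∞ := ENNReal.ofReal (256 * ε) with hη
  have hη1 : η ≤ 1 := by
    rw [hη, ENNReal.ofReal_le_one]; linarith
  set P := uniformMixture h η hη1 with hP
  set X : Finset (Str (32 * (k + 1))) := h.support.toFinset with hX
  have hXcard : X.card ≤ 2 ^ (10 * k) := by
    rw [hX, ← Set.ncard_eq_toFinset_card']; exact hsupp
  have hX0 : ∀ x ∉ X, h x = 0 := by
    intro x hx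
    rw [hX, Set.mem_toFinset, PMF.mem_support_iff, not_not] at hx
    exact hx
  have hdist := le_distFrom_boundedSupport (m := m) k.succ_pos hr hmup P η fun x => by
    rw [hP, uniformMixture, PMF.ofFintype_apply]
    exact le_add_self
  have hfar : ENNReal.ofReal ε < distFrom (P.map fun x => x ∘ block (32 * (k + 1)) r)
      (boundedSupport m (32 * (k + 1) * r)) := by
    refine lt_of_lt_of_le ?_ hdist
    rw [hη, show (128 : ℝ≥0∞) = ENNReal.ofReal 128 by simp,
      ← ENNReal.ofReal_div_of_pos (by norm_num)]
    exact (ENNReal.ofReal_lt_ofReal_iff (by positivity)).2 (by linarith)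
  have hrej := hA.1.2 _ hfar
  -- As `X.card ≤ m / 2`, this is an admissible `R`, and it is at least `m / 2`. Every pattern on at
  -- most `k` bits has positive mass under `h`, so it occurs in `X`.
  have hmain := hA.rejection_mul_le (R := m + 1 - m / 2) (k := k) hm0 hAq
    (block (32 * (k + 1)) r) P X η
    (fun J hJ a => uniformMixture_agree_notMem_le h η hη1 X hX0 J a (hagree J hJ.le a))
    (by omega) (fun J hJ a => by
      by_contra! hcon
      have h1 := hagree J hJ a
      rw [Finset.sum_eq_zero] at h1
      · exact ENNReal.inv_ne_zero.2 (by finiteness) h1.symm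
      · intro x hx
        refine hX0 x fun hxX => ?_
        obtain ⟨j, hj, hne⟩ := hcon x hxX
        exact hne ((Finset.mem_filter.1 hx).2 j hj))
  have hle : (2 / 3 : ℝ≥0∞) * ((m + 1 - m / 2 : ℕ) * (k + 1 : ℕ)) ≤ η * q :=
    le_trans (by gcongr) hmain
  have hreal : (2 / 3 : ℝ) * ((m + 1 - m / 2 : ℕ) * (k + 1 : ℕ)) ≤ 256 * ε * q := by
    have h1 := ENNReal.toReal_mono (by finiteness) hle
    simpa only [hη, ENNReal.toReal_mul, ENNReal.toReal_ofReal (by positivity : 0 ≤ 256 * ε),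
      ENNReal.toReal_natCast, ENNReal.toReal_div, ENNReal.toReal_ofNat] using h1
  have hR : (m : ℝ) / 2 ≤ (m + 1 - m / 2 : ℕ) := by
    rw [div_le_iff₀ (by norm_num)]
    exact_mod_cast (by omega : m ≤ (m + 1 - m / 2) * 2)
  have hk : (0 : ℝ) ≤ ((k + 1 : ℕ) : ℝ) := by positivity
  have h2 := mul_le_mul_of_nonneg_right hR hk
  push_cast at h2 hreal ⊢
  linarith

end HugeObject

theorem mainTheorem5 :
    ∃ c ε₀ : ℝ, 0 < c ∧ 0 < ε₀ ∧ ∀ m : ℕ, 2 ≤ m →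
      {n : ℕ | ∀ ε : ℝ, 0 < ε → ε < ε₀ →
        ∀ (s q : ℕ) (A : HugeObject.RandAlg s n),
          HugeObject.IsOneSidedTest A ε (HugeObject.boundedSupport m n) →
          A.MakesAtMost q →
          c * ε⁻¹ * m * Real.log m ≤ q}.Infinite := by
  refine ⟨1 / 10000, 1 / 256, by norm_num, by norm_num, fun m hm => ?_⟩
  -- The largest `k` with `2 ^ (10 * k) ≤ m / 2`; maximality gives `m ≤ 2 ^ (11 * (k + 1))`, hence
  -- `k + 1` is at least `log m / 11`.
  set k := Nat.log 2 (m / 2) / 10 with hk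
  refine Set.infinite_of_injective_forall_mem (f := fun r : ℕ => 32 * (k + 1) * (r + 1)) ?_ ?_
  · intro r r' h
    have := Nat.eq_of_mul_eq_mul_left (by positivity) h
    omega
  intro r ε hε hε' s q A hA hAq
  have hlow : 2 ^ (10 * k) ≤ m / 2 :=
    (Nat.pow_le_pow_right (by norm_num) (by omega)).trans (Nat.pow_log_le_self 2 (by omega))
  have hup : m ≤ 2 ^ (11 * (k + 1)) := by
    have h1 := Nat.lt_pow_succ_log_self (b := 2) (by norm_num) (m / 2)
    have h2 : 2 ^ (Nat.log 2 (m / 2)).succ ≤ 2 ^ (10 * (k + 1)) :=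
      Nat.pow_le_pow_right (by norm_num) (by omega)
    have h3 : 2 ^ (10 * (k + 1) + 1) ≤ 2 ^ (11 * (k + 1)) :=
      Nat.pow_le_pow_right (by norm_num) (by omega)
    rw [pow_succ] at h3
    omega
  have hmain := hA.mul_le_queries r.succ_pos hlow hup hε hε' hAq
  have hlog : Real.log m ≤ 11 * (k + 1) := by
    have h1 : Real.log m ≤ Real.log (2 ^ (11 * (k + 1))) :=
      Real.log_le_log (by positivity) (by exact_mod_cast hup)
    rw [Real.log_pow] at h1
    have h2 : Real.log 2 ≤ 1 := Real.log_two_lt_d9.le.trans (by norm_num)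
    have h3 : (0 : ℝ) ≤ ((11 * (k + 1) : ℕ) : ℝ) := by positivity
    have h4 := mul_le_mul_of_nonneg_left h2 h3
    push_cast at h1 h4
    linarith
  have h5 : (m : ℝ) * Real.log m ≤ 11 * (768 * ε * q) := by
    have := mul_le_mul_of_nonneg_left hlog (Nat.cast_nonneg (α := ℝ) m)
    linarith
  -- The constant only has to satisfy `11 * 768 = 8448 ≤ 10000`.
  calc 1 / 10000 * ε⁻¹ * m * Real.log m = 1 / 10000 * ε⁻¹ * (m * Real.log m) := by ring
    _ ≤ 1 / 10000 * ε⁻¹ * (11 * (768 * ε * q)) := by gcongr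
    _ = 8448 / 10000 * q := by field_simp; ring
    _ ≤ q := by linarith [Nat.cast_nonneg (α := ℝ) q]
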